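/- Let $\mathbb{K}$ be a field, $n\ge 0$, $S=\mathbb{K}[x_1,\dots,x_n,y_1,\dots,y_n]$, and let $\sigma$ be the lexicographic term order on $S$ induced by $x_1>\cdots>x_n>y_1>\cdots>y_n$. Let $G$ be a simple graph on the vertex set $[n]=\{1,\dots,n\}$ with edge set $E(G)$. For $e=\{i,j\}\in E(G)$ with $i<j$ put $f_e=x_iy_j-x_jy_i$, and let $J_G=(f_e : e\in E(G))\subset S$ be the binomial edge ideal of $G$. Assume that $G$ is closed with respect to the given labelling of its vertices, i.e. that $\{f_e : e\in E(G)\}$ is a Gröbner basis of $J_G$ with respect to $\sigma$. For an ideal $I\subset S$ let $\mathcal{R}(I)=\bigoplus_{k\ge 0}I^kt^k\subset S[t]$ be its Rees algebra and $\operatorname{in}_\sigma(I)$ its initial ideal. Let $\tau$ be the term order on $S[t]$ with $ut^i<_\tau vt^j$ if and only if $i<j$, or $i=j$ and $u<_\sigma v$ (for monomials $u,v\in S$). For a $\mathbb{K}$-subalgebra $A\subset S[t]$ let $\operatorname{in}_\tau(A)$ be the $\mathbb{K}$-subalgebra of $S[t]$ generated by the initial monomials $\operatorname{in}_\tau(a)$,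 $0\neq a\in A$; a subset $F\subset A$ is a Sagbi basis of $A$ with respect to $\tau$ if $\operatorname{in}_\tau(A)$ is generated as a $\mathbb{K}$-algebra by $\{\operatorname{in}_\tau(f) : 0\ne f\in F\}$. The relation type $\operatorname{reltype}(I)$ of a homogeneous ideal $I$ with minimal homogeneous generating set $\{g_1,\dots,g_r\}$ is the largest degree in $T_1,\dots,T_r$ of a minimal generator (homogeneous in the $T_i$) of the kernel of the $S$-algebra homomorphism $S[T_1,\dots,T_r]\to S[t]$, $T_i\mapsto g_it$ (and $0$ if this kernel is zero); it does not depend on the choices. Then $$\operatorname{in}_\tau(\mathcal{R}(J_G))=\mathcal{R}(\operatorname{in}_\sigma(J_G))\qquad\text{and}\qquad \operatorname{reltype}(J_G)\le 2.$$ Moreover, the set $\{x_i,y_i : 1\le i\le n\}\cup\{f_et : e\in E(G)\}$ is a Sagbi basis of $\mathcal{R}(J_G)$ with respect to $\tau$. -/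

import Mathlib

namespace BinomialEdge

noncomputable section

open MvPolynomial
open scoped MonomialOrder

/-! ### Initial monomials, initial ideals and Gröbner bases in `S = K[x_ι]` -/

section TermOrder

variable {ι K : Type*} [Field K]

/-- The initial monomials `in_σ(f)` of the nonzero elements `f` of a set `F ⊆ S`, for a term order
`σ` (`m` below). -/
def initialMonomials (m : MonomialOrder ι) (F : Set (MvPolynomial ι K)) :
    Set (MvPolynomial ι K) :=
  {q | ∃ f ∈ F, f ≠ 0 ∧ q = monomial (m.degree f) 1}

/-- The initial ideal `in_σ(I)`: the ideal generated by the initial monomials of the nonzero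
elements of `I`. -/
def initialIdeal (m : MonomialOrder ι) (I : Ideal (MvPolynomial ι K)) :
    Ideal (MvPolynomial ι K) :=
  Ideal.span (initialMonomials m (I : Set (MvPolynomial ι K)))

/-- `F` is a Gröbner basis of `I` with respect to `σ`. -/
def IsGroebnerBasis (m : MonomialOrder ι) (F : Set (MvPolynomial ι K))
    (I : Ideal (MvPolynomial ι K)) : Prop :=
  F ⊆ I ∧ Ideal.span (initialMonomials m F) = initialIdeal m I

/-! ### The term order `τ` on `S[t]`, initial algebras and Sagbi bases

The monomial `u t ^ i` of `S[t]`, where `u` is the monomial of `S` with exponent vector `a`, is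
encoded by the pair `(i, a)`. -/

/-- The strict order of `τ`: `u t ^ i <_τ v t ^ j` iff `i < j`, or `i = j` and `u <_σ v`. -/
def tauLT (m : MonomialOrder ι) (a b : ℕ × (ι →₀ ℕ)) : Prop :=
  a.1 < b.1 ∨ (a.1 = b.1 ∧ a.2 ≺[m] b.2)

/-- `a` is the exponent of the initial monomial of `f ∈ S[t]` with respect to `τ`: that monomial
occurs in `f`, and every other monomial occurring in `f` is `τ`-smaller.
(No `a` qualifies if `f = 0`.) -/
def IsTauInitial (m : MonomialOrder ι) (f : Polynomial (MvPolynomial ι K))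
    (a : ℕ × (ι →₀ ℕ)) : Prop :=
  (f.coeff a.1).coeff a.2 ≠ 0 ∧
    ∀ b : ℕ × (ι →₀ ℕ), (f.coeff b.1).coeff b.2 ≠ 0 → b = a ∨ tauLT m b a

/-- The initial monomials `in_τ(f)` of the nonzero elements `f` of a set `F ⊆ S[t]`. -/
def tauInitialMonomials (m : MonomialOrder ι) (F : Set (Polynomial (MvPolynomial ι K))) :
    Set (Polynomial (MvPolynomial ι K)) :=
  {q | ∃ f ∈ F, ∃ a : ℕ × (ι →₀ ℕ), IsTauInitial m f a ∧
    q = Polynomial.monomial a.1 (monomial a.2 (1 : K))}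

/-- The initial algebra `in_τ(A)` of a `K`-subalgebra `A` of `S[t]`: the `K`-subalgebra generated
by the initial monomials of the nonzero elements of `A`. -/
def tauInitialAlgebra (m : MonomialOrder ι)
    (A : Subalgebra K (Polynomial (MvPolynomial ι K))) :
    Subalgebra K (Polynomial (MvPolynomial ι K)) :=
  Algebra.adjoin K (tauInitialMonomials m (A : Set (Polynomial (MvPolynomial ι K))))

/-- `F` is a Sagbi basis of `A` with respect to `τ`: `F ⊆ A`, and the initial monomials of the
elements of `F` generate the initial algebra of `A` as a `K`-algebra. -/
def IsTauSagbiBasis (m : MonomialOrder ι) (F : Set (Polynomial (MvPolynomial ι K)))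
    (A : Subalgebra K (Polynomial (MvPolynomial ι K))) : Prop :=
  F ⊆ A ∧ Algebra.adjoin K (tauInitialMonomials m F) = tauInitialAlgebra m A

/-- The Rees algebra `⨁ I ^ k t ^ k ⊆ S[t]`, regarded as a `K`-subalgebra of `S[t]`. -/
def rees (I : Ideal (MvPolynomial ι K)) : Subalgebra K (Polynomial (MvPolynomial ι K)) :=
  (reesAlgebra I).restrictScalars K

/-! ### Relation type -/

/-- `f` is a minimal (i.e. irredundant) finite system of homogeneous generators of `I`. -/
def IsMinimalHomogeneousGenerators {r : ℕ} (f : Fin r → MvPolynomial ι K)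
    (I : Ideal (MvPolynomial ι K)) : Prop :=
  (∀ i, ∃ d, (f i).IsHomogeneous d) ∧ Ideal.span (Set.range f) = I ∧
    ∀ i, f i ∉ Ideal.span (f '' {j | j ≠ i})

/-- The `S`-algebra homomorphism `ψ : S[T_1, …, T_r] → S[t]` with `ψ(T_i) = f_i t`. -/
def psi {r : ℕ} (f : Fin r → MvPolynomial ι K) :
    MvPolynomial (Fin r) (MvPolynomial ι K) →ₐ[MvPolynomial ι K] Polynomial (MvPolynomial ι K) :=
  aeval fun i => Polynomial.C (f i) * Polynomial.X

/-- The defining ideal `ker ψ` of the Rees algebra. -/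
def definingIdeal {r : ℕ} (f : Fin r → MvPolynomial ι K) :
    Ideal (MvPolynomial (Fin r) (MvPolynomial ι K)) :=
  RingHom.ker (psi f)

/-- `B` is a minimal (i.e. irredundant) generating set of `L ⊆ S[T_1, …, T_r]` by elements that are
homogeneous with respect to the `T`-degree (elements of `S` have `T`-degree `0`). -/
def IsMinimalTGenerators {r : ℕ} (B : Set (MvPolynomial (Fin r) (MvPolynomial ι K)))
    (L : Ideal (MvPolynomial (Fin r) (MvPolynomial ι K))) : Prop :=
  (∀ p ∈ B, ∃ d, p.IsHomogeneous d) ∧ Ideal.span B = L ∧ ∀ p ∈ B, p ∉ Ideal.span (B \ {p})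

/-- The relation type of a homogeneous ideal `I`: the largest `T`-degree of a minimal generator of
the defining ideal of its Rees algebra (`0` if the defining ideal is zero). This number does not
depend on the minimal generating system `f` of `I`, nor on the minimal generating set `B` of the
defining ideal, so the supremum over all choices is the common value. -/
def relationType (I : Ideal (MvPolynomial ι K)) : ℕ∞ :=
  sSup {d : ℕ∞ | ∃ (r : ℕ) (f : Fin r → MvPolynomial ι K)
    (B : Set (MvPolynomial (Fin r) (MvPolynomial ι K))),
    IsMinimalHomogeneousGenerators f I ∧ IsMinimalTGenerators B (definingIdeal f) ∧
    ∃ p ∈ B, ∃ k : ℕ, p.IsHomogeneous k ∧ d = k}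

end TermOrder

/-! ### Binomial edge ideals -/

section Graph

/-- The variables `x_1, …, x_n, y_1, …, y_n`, listed in this order. -/
abbrev Var (n : ℕ) : Type := Fin n ⊕ₗ Fin n

variable {n : ℕ} (K : Type*) [Field K]

/-- The variable `x_i`. -/
def x (i : Fin n) : MvPolynomial (Var n) K := X (Sum.inlₗ i)

/-- The variable `y_i`. -/
def y (i : Fin n) : MvPolynomial (Var n) K := X (Sum.inrₗ i)

/-- `f_{i,j} = x_i y_j - x_j y_i`. -/
def edgeBinomial (i j : Fin n) : MvPolynomial (Var n) K := x K i * y K j - x K j * y K i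

/-- The generators `f_e = x_i y_j - x_j y_i`, for `e = {i, j} ∈ E(G)` with `i < j`. -/
def edgeBinomials (G : SimpleGraph (Fin n)) : Set (MvPolynomial (Var n) K) :=
  {f | ∃ i j : Fin n, i < j ∧ G.Adj i j ∧ f = edgeBinomial K i j}

/-- The binomial edge ideal `J_G`. -/
def binomialEdgeIdeal (G : SimpleGraph (Fin n)) : Ideal (MvPolynomial (Var n) K) :=
  Ideal.span (edgeBinomials K G)

/-- The lexicographic term order `σ` on `S` induced by `x_1 > ⋯ > x_n > y_1 > ⋯ > y_n`
(in `MonomialOrder.lex`, variables with smaller index are larger). -/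
def sigma (n : ℕ) : MonomialOrder (Var n) := MonomialOrder.lex

/-- `G` is closed with respect to the given labelling of its vertices: the generators `f_e` of
`J_G`, which are quadrics, form a Gröbner basis of `J_G` with respect to `σ`. -/
def IsClosedLabelling (G : SimpleGraph (Fin n)) : Prop :=
  IsGroebnerBasis (sigma n) (edgeBinomials K G) (binomialEdgeIdeal K G)

/-- The subset `{x_i, y_i : 1 ≤ i ≤ n} ∪ {f_e t : e ∈ E(G)}` of `S[t]`. -/
def reesGenerators (G : SimpleGraph (Fin n)) : Set (Polynomial (MvPolynomial (Var n) K)) :=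
  Set.range (fun i : Fin n => Polynomial.C (x K i)) ∪
    Set.range (fun i : Fin n => Polynomial.C (y K i)) ∪
    (fun f => Polynomial.C f * Polynomial.X) '' edgeBinomials K G

end Graph

end

end BinomialEdge

/-! The argument is Sagbi lifting. Give a monomial z^a T^c the weight consisting of its T-degree and
the initial exponent of z^a ∏ f_e^{c_e}; the initial term of f_e is x_i y_j for e = {i, j}, i < j.
Let L be generated by the T-homogeneous relations of degree at most 2. Suppose any two monomials of
equal weight are congruent modulo L and monomials of the same T-degree and σ-smaller weight
(`linked_of_weight_eq`). Descending along σ, every T-form is congruent modulo L to a combination of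
monomials of distinct weights (`exists_normal_form`). The values of these have distinct initial
monomials and cannot cancel. Hence a form of value 0 lies in L, which bounds the relation type, and
the initial exponent of a nonzero element of J_G^k is a weight of T-degree k, which gives the
initial algebra (`eval_eq_zero_or_exists_degree`).

The congruences are a matching problem: T_e pairs x_i with y_j, and the variables in z^a are
unmatched. Four identities supply the moves: two linear syzygies of 2-minors (`linked_x`,
`linked_y`), the Koszul relation (`linked_koszul`) and the Plücker relation (`linked_swap`).
Closedness supplies the edges occurring in their smaller terms. It remains to move two monomials of
equal weight until they share a variable, cancel it and induct (`exists_common`,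
`connected_of_exists_common`). -/

namespace BinomialEdge

noncomputable section

open MvPolynomial
open scoped MonomialOrder

/-! ### Presentations of Rees algebras -/

section Presentation

variable {R E : Type*} [CommRing R]

/-- The `R`-algebra homomorphism `R[T_e : e ∈ E] → R[t]` with `T_e ↦ f_e t`. -/
def reesHom (f : E → R) : MvPolynomial E R →ₐ[R] Polynomial R :=
  aeval fun e => Polynomial.C (f e) * Polynomial.X

/-- The ideal generated by the homogeneous relations of degree at most `N`. -/
def relationsUpTo (f : E → R) (N : ℕ) : Ideal (MvPolynomial E R) :=
  Ideal.span {q | ∃ d ≤ N, q.IsHomogeneous d ∧ reesHom f q = 0}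

lemma reesHom_of_isHomogeneous (f : E → R) {q : MvPolynomial E R} {d : ℕ}
    (hq : q.IsHomogeneous d) : reesHom f q = Polynomial.C (eval f q) * Polynomial.X ^ d := by
  rw [reesHom, aeval_def, eval₂_eq, eval_eq, map_sum, Finset.sum_mul]
  refine Finset.sum_congr rfl fun s hs => ?_
  have h : ∑ i ∈ s.support, s i = d := by
    have := hq (mem_support_iff.1 hs)
    simpa [Finsupp.weight_apply, Finsupp.sum] using this
  simp only [mul_pow, Finset.prod_mul_distrib, Finset.prod_pow_eq_pow_sum, h, map_mul, map_prod,
    map_pow, Polynomial.algebraMap_eq, mul_assoc]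

lemma reesHom_eq_zero_iff (f : E → R) {q : MvPolynomial E R} {d : ℕ} (hq : q.IsHomogeneous d) :
    reesHom f q = 0 ↔ eval f q = 0 := by
  rw [reesHom_of_isHomogeneous f hq, Polynomial.C_mul_X_pow_eq_monomial,
    Polynomial.monomial_eq_zero_iff]

lemma mem_relationsUpTo (f : E → R) {q : MvPolynomial E R} {d N : ℕ} (hd : d ≤ N)
    (hq : q.IsHomogeneous d) (h : eval f q = 0) : q ∈ relationsUpTo f N :=
  Ideal.subset_span ⟨d, hd, hq, (reesHom_eq_zero_iff f hq).2 h⟩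

lemma relationsUpTo_le_ker (f : E → R) (N : ℕ) : relationsUpTo f N ≤ RingHom.ker (reesHom f) :=
  Ideal.span_le.2 fun _ ⟨_, _, _, h⟩ => h

/-- The map turns T-degree into t-degree, so its kernel is graded and can be tested on homogeneous
components. -/
lemma coeff_reesHom (f : E → R) (p : MvPolynomial E R) (k : ℕ) :
    (reesHom f p).coeff k = eval f (homogeneousComponent k p) := by
  conv_lhs => rw [← sum_homogeneousComponent p]
  simp only [map_sum, Polynomial.finsetSum_coeff,
    reesHom_of_isHomogeneous f (homogeneousComponent_isHomogeneous _ p),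
    Polynomial.coeff_C_mul_X_pow]
  rw [Finset.sum_ite_eq]
  split_ifs with h
  · rfl
  · rw [homogeneousComponent_eq_zero, map_zero]
    simpa using h

/-- A relation all of whose homogeneous components lie in `L` lies in `L`. -/
lemma ker_reesHom_le {f : E → R} {L : Ideal (MvPolynomial E R)}
    (h : ∀ (k : ℕ) (p : MvPolynomial E R), p.IsHomogeneous k → eval f p = 0 → p ∈ L) :
    RingHom.ker (reesHom f) ≤ L := by
  intro p hp
  rw [← sum_homogeneousComponent p]
  refine Ideal.sum_mem _ fun k _ => h k _ (homogeneousComponent_isHomogeneous k p) ?_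
  rw [← coeff_reesHom, (RingHom.mem_ker).1 hp, Polynomial.coeff_zero]

/-- Writing each f_i through the g's gives a degree-preserving substitution between the two
presentations. -/
lemma exists_linear_forms_of_span_le [Finite E] {F : Type*} {f : F → R} {g : E → R}
    (h : Ideal.span (Set.range f) ≤ Ideal.span (Set.range g)) :
    ∃ φ : F → MvPolynomial E R, (∀ i, (φ i).IsHomogeneous 1) ∧ ∀ i, eval g (φ i) = f i := by
  have key : ∀ i, ∃ q : MvPolynomial E R, q.IsHomogeneous 1 ∧ eval g q = f i := fun i => by
    rw [← Ideal.mem_span_pow_iff_exists_isHomogeneous, pow_one]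
    exact h (Ideal.subset_span ⟨i, rfl⟩)
  choose φ hφ using key
  exact ⟨φ, fun i => (hφ i).1, fun i => (hφ i).2⟩

lemma isHomogeneous_aeval_linear {F : Type*} {φ : F → MvPolynomial E R}
    (hφ : ∀ i, (φ i).IsHomogeneous 1) {q : MvPolynomial F R} {d : ℕ} (hq : q.IsHomogeneous d) :
    (aeval φ q).IsHomogeneous d := by
  simpa using hq.aeval φ hφ

lemma eval_aeval_eq {F : Type*} {φ : F → MvPolynomial E R} {f : F → R} {g : E → R}
    (h : ∀ i, eval g (φ i) = f i) (q : MvPolynomial F R) :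
    eval g (aeval φ q) = eval f q := by
  induction q using MvPolynomial.induction_on with
  | C r => simp
  | add p q hp hq => simp only [map_add, hp, hq]
  | mul_X p i hp => simp only [map_mul, aeval_X, eval_X, hp, h]

/-- If the relations among one system of generators are generated in degrees at most `N`, where
`N ≥ 1`, then so are the relations among every other system generating the same ideal. -/
lemma ker_reesHom_le_relationsUpTo {F : Type*} [Finite E] [Finite F] {f : E → R} {g : F → R}
    {N : ℕ} (hN : 1 ≤ N) (hfg : Ideal.span (Set.range f) = Ideal.span (Set.range g))
    (hg : RingHom.ker (reesHom g) ≤ relationsUpTo g N) :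
    RingHom.ker (reesHom f) ≤ relationsUpTo f N := by
  obtain ⟨φ, hφ1, hφ⟩ := exists_linear_forms_of_span_le hfg.le
  obtain ⟨χ, hχ1, hχ⟩ := exists_linear_forms_of_span_le hfg.ge
  refine ker_reesHom_le fun k p hp h0 => ?_
  have h1 : aeval χ (aeval φ p) ∈ relationsUpTo f N := by
    have h2 : aeval φ p ∈ relationsUpTo g N := by
      refine hg ?_
      rw [RingHom.mem_ker]
      refine (reesHom_eq_zero_iff g (isHomogeneous_aeval_linear hφ1 hp)).2 ?_
      rw [eval_aeval_eq hφ, h0]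
    have h3 : relationsUpTo g N ≤ (relationsUpTo f N).comap (aeval χ) := by
      refine Ideal.span_le.2 ?_
      rintro q ⟨d, hd, hq, hq0⟩
      refine mem_relationsUpTo f hd (isHomogeneous_aeval_linear hχ1 hq) ?_
      rw [eval_aeval_eq hχ]
      exact (reesHom_eq_zero_iff g hq).1 hq0
    exact h3 h2
  -- The round trip is the identity modulo the linear relations T_i - χ(φ(T_i)); this is where `1 ≤
  -- N` is needed. The induction passes through inhomogeneous polynomials, so the facts about `p`
  -- are dropped.
  have h4 : p - aeval χ (aeval φ p) ∈ relationsUpTo f N := by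
    clear h1 h0 hp
    induction p using MvPolynomial.induction_on with
    | C r => simp
    | add p q hp hq =>
      convert Ideal.add_mem _ hp hq using 1
      simp only [map_add]; ring
    | mul_X p i hp =>
      have hX : X i - aeval χ (φ i) ∈ relationsUpTo f N := by
        refine mem_relationsUpTo f hN ((isHomogeneous_X R i).sub
          (isHomogeneous_aeval_linear hχ1 (hφ1 i))) ?_
        rw [map_sub, eval_aeval_eq hχ, hφ i, eval_X, sub_self]
      convert Ideal.add_mem _ (Ideal.mul_mem_right (X i) _ hp)
        (Ideal.mul_mem_left _ (aeval χ (aeval φ p)) hX) using 1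
      simp only [map_mul, aeval_X]; ring
  simpa using Ideal.add_mem _ h4 h1

end Presentation

/-! ### Relation type and degrees of minimal relations -/

section RelationType

variable {ι K : Type*} [Field K]

/-- An irredundant homogeneous generating set of an ideal generated in degrees at most `N` has
no element of degree greater than `N`. -/
lemma IsMinimalTGenerators.degree_le {r : ℕ} {f : Fin r → MvPolynomial ι K}
    {B : Set (MvPolynomial (Fin r) (MvPolynomial ι K))} {N k : ℕ}
    (hB : IsMinimalTGenerators B (definingIdeal f))
    (hN : RingHom.ker (reesHom f) ≤ relationsUpTo f N)
    {p : MvPolynomial (Fin r) (MvPolynomial ι K)} (hp : p ∈ B) (hk : p.IsHomogeneous k) :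
    k ≤ N := by
  by_contra! hlt
  obtain ⟨hhom, hspan, hirr⟩ := hB
  -- In the degree-d part of an expression of q through B, multiples of p contribute nothing, as d ≤
  -- N < k.
  have hle : relationsUpTo f N ≤ Ideal.span (B \ {p}) := by
    refine Ideal.span_le.2 ?_
    rintro q ⟨d, hd, hq, hq0⟩
    have hqB : q ∈ Ideal.span B := by rw [hspan]; exact hq0
    obtain ⟨c, hc⟩ := (Finsupp.mem_span_iff_linearCombination (MvPolynomial (Fin r) (MvPolynomial ι K)) B q).1 hqB
    have hq' : q = homogeneousComponent d q := by
      rw [homogeneousComponent_of_mem ((mem_homogeneousSubmodule _ _).2 hq), if_pos rfl]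
    rw [hq', ← hc, Finsupp.linearCombination_apply, Finsupp.sum, map_sum]
    refine Ideal.sum_mem _ fun b _ => ?_
    -- For p itself the degree is fixed to be k, which avoids any appeal to uniqueness of degrees.
    obtain ⟨e, he, hek⟩ : ∃ e, b.1.IsHomogeneous e ∧ (b.1 = p → e = k) := by
      by_cases hb : b.1 = p
      · exact ⟨k, hb ▸ hk, fun _ => rfl⟩
      · exact (hhom b b.2).imp fun e he => ⟨he, fun h => absurd h hb⟩
    rw [smul_eq_mul, ← sum_homogeneousComponent (c b), Finset.sum_mul, map_sum]
    refine Ideal.sum_mem _ fun i _ => ?_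
    rw [homogeneousComponent_of_mem ((mem_homogeneousSubmodule _ _).2
      ((homogeneousComponent_isHomogeneous i (c b)).mul he))]
    split_ifs with hd'
    · refine Ideal.mul_mem_left _ _ (Ideal.subset_span ⟨b.2, fun hb => ?_⟩)
      have := hek hb
      omega
    · exact Ideal.zero_mem _
  have hpL : p ∈ definingIdeal f := hspan ▸ Ideal.subset_span hp
  exact hirr p hp (hle (hN hpL))

lemma relationType_le {I : Ideal (MvPolynomial ι K)} {E : Type*} [Finite E]
    {g : E → MvPolynomial ι K} {N : ℕ} (hN : 1 ≤ N) (hg : Ideal.span (Set.range g) = I)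
    (h : RingHom.ker (reesHom g) ≤ relationsUpTo g N) : relationType I ≤ N := by
  refine sSup_le ?_
  rintro d ⟨r, f, B, hf, hB, p, hp, k, hk, rfl⟩
  exact_mod_cast hB.degree_le (ker_reesHom_le_relationsUpTo hN (hf.2.1.trans hg.symm) h) hp hk

end RelationType

/-! ### Lifting relations between initial monomials -/

section Lifting

variable {ι E K : Type*} [Field K]

/-- The monomial `z ^ a * T ^ c` of `K[z][T]`. -/
def mon (K : Type*) [Field K] (u : (E →₀ ℕ) × (ι →₀ ℕ)) : MvPolynomial E (MvPolynomial ι K) :=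
  monomial u.1 (monomial u.2 1)

/-- The exponent of `(∏ e, (z ^ ε e * t) ^ c e) * z ^ a`. -/
def weight (ε : E → ι →₀ ℕ) : (E →₀ ℕ) × (ι →₀ ℕ) →+ ℕ × (ι →₀ ℕ) :=
  AddMonoidHom.prod (Finsupp.degree.comp (AddMonoidHom.fst _ _))
    (AddMonoidHom.snd _ _ +
      (Finsupp.linearCombination ℕ ε).toAddMonoidHom.comp (AddMonoidHom.fst _ _))

lemma weight_apply (ε : E → ι →₀ ℕ) (u : (E →₀ ℕ) × (ι →₀ ℕ)) :
    weight ε u = (u.1.degree, u.2 + Finsupp.linearCombination ℕ ε u.1) := rfl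

lemma mon_add (u v : (E →₀ ℕ) × (ι →₀ ℕ)) : mon K (u + v) = mon K u * mon K v := by
  simp [mon, monomial_mul]

lemma mon_isHomogeneous (ε : E → ι →₀ ℕ) (u : (E →₀ ℕ) × (ι →₀ ℕ)) :
    (mon K u).IsHomogeneous (weight ε u).1 :=
  isHomogeneous_monomial _ rfl

lemma mem_span_mon_of_isHomogeneous {k : ℕ} {p : MvPolynomial E (MvPolynomial ι K)}
    (hp : p.IsHomogeneous k) :
    p ∈ Submodule.span K (mon K '' {u | u.1.degree = k}) := by
  rw [p.as_sum]
  refine Submodule.sum_mem _ fun c hc => ?_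
  rw [(coeff c p).as_sum, map_sum]
  refine Submodule.sum_mem _ fun a _ => ?_
  have h : c.degree = k := by
    by_contra h
    exact mem_support_iff.1 hc (hp.coeff_eq_zero h)
  have : monomial c (monomial a (coeff a (coeff c p))) = coeff a (coeff c p) • mon K (c, a) := by
    rw [mon, smul_monomial, smul_monomial, smul_eq_mul, mul_one]
  rw [this]
  exact Submodule.smul_mem _ _ (Submodule.subset_span ⟨(c, a), h, rfl⟩)

variable (m : MonomialOrder ι) (ε : E → ι →₀ ℕ)
  (L : Ideal (MvPolynomial E (MvPolynomial ι K)))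

/-- Sums of an element of `L` and monomials of the same `T`-degree as `w` and smaller weight. -/
def remainders (w : ℕ × (ι →₀ ℕ)) : Submodule K (MvPolynomial E (MvPolynomial ι K)) :=
  L.restrictScalars K ⊔
    Submodule.span K (mon K '' {u | (weight ε u).1 = w.1 ∧ (weight ε u).2 ≺[m] w.2})

variable {m ε L}

lemma mem_remainders_of_mem {w : ℕ × (ι →₀ ℕ)} {p : MvPolynomial E (MvPolynomial ι K)}
    (hp : p ∈ L) : p ∈ remainders m ε L w :=
  Submodule.mem_sup_left hp

lemma mon_mem_remainders {w : ℕ × (ι →₀ ℕ)} {u : (E →₀ ℕ) × (ι →₀ ℕ)}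
    (h1 : (weight ε u).1 = w.1) (h2 : (weight ε u).2 ≺[m] w.2) :
    mon K u ∈ remainders m ε L w :=
  Submodule.mem_sup_right (Submodule.subset_span ⟨u, ⟨h1, h2⟩, rfl⟩)

/-- L is an ideal and the term order is compatible with multiplication, so congruences can be
multiplied by monomials. -/
lemma mon_mul_mem_remainders {w : ℕ × (ι →₀ ℕ)} (d : (E →₀ ℕ) × (ι →₀ ℕ))
    {p : MvPolynomial E (MvPolynomial ι K)} (hp : p ∈ remainders m ε L w) :
    mon K d * p ∈ remainders m ε L (weight ε d + w) := by
  have h : remainders m ε L w ≤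
      (remainders m ε L (weight ε d + w)).comap (LinearMap.mulLeft K (mon K d)) := by
    refine sup_le (fun q hq => mem_remainders_of_mem (L.mul_mem_left _ hq)) ?_
    refine Submodule.span_le.2 ?_
    rintro _ ⟨u, ⟨h1, h2⟩, rfl⟩
    change mon K d * mon K u ∈ remainders m ε L (weight ε d + w)
    rw [← mon_add]
    refine mon_mem_remainders ?_ ?_
    · rw [map_add, Prod.fst_add, Prod.fst_add, h1]
    · rw [map_add, Prod.snd_add, Prod.snd_add, map_add, map_add]
      exact add_lt_add_right h2 _
  exact h hp

variable (m ε L) in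
/-- The monomials with exponents `u` and `v` have the same weight, and agree up to an element of
`L` and monomials of smaller weight. -/
def Connected (u v : (E →₀ ℕ) × (ι →₀ ℕ)) : Prop :=
  weight ε u = weight ε v ∧ mon K u - mon K v ∈ remainders m ε L (weight ε u)

namespace Connected

lemma refl (u : (E →₀ ℕ) × (ι →₀ ℕ)) : Connected m ε L u u :=
  ⟨rfl, by rw [sub_self]; exact Submodule.zero_mem _⟩

lemma symm {u v : (E →₀ ℕ) × (ι →₀ ℕ)} (h : Connected m ε L u v) : Connected m ε L v u :=
  ⟨h.1.symm, by rw [← h.1, ← neg_sub]; exact Submodule.neg_mem _ h.2⟩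

lemma trans {u v w : (E →₀ ℕ) × (ι →₀ ℕ)} (h : Connected m ε L u v)
    (h' : Connected m ε L v w) : Connected m ε L u w :=
  ⟨h.1.trans h'.1, by
    rw [← sub_add_sub_cancel _ (mon K v)]
    exact Submodule.add_mem _ h.2 (h.1 ▸ h'.2)⟩

lemma add_left {u v : (E →₀ ℕ) × (ι →₀ ℕ)} (h : Connected m ε L u v)
    (d : (E →₀ ℕ) × (ι →₀ ℕ)) : Connected m ε L (d + u) (d + v) :=
  ⟨by rw [map_add, map_add, h.1], by
    rw [mon_add, mon_add, ← mul_sub, map_add]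
    exact mon_mul_mem_remainders d h.2⟩

end Connected

/-- To connect exponents of equal weight it suffices to move them, inside their class, to
exponents that have a variable in common. -/
lemma connected_of_exists_common
    (h : ∀ u v, weight ε u = weight ε v → u ≠ 0 → ∃ u' v' z, Connected m ε L u u' ∧
      Connected m ε L v v' ∧ z ≠ 0 ∧ z ≤ u' ∧ z ≤ v')
    (u v : (E →₀ ℕ) × (ι →₀ ℕ)) (huv : weight ε u = weight ε v) : Connected m ε L u v := by
  -- The weight vanishes only at 0, so cancelling z ≠ 0 strictly lowers the T-degree plus the total
  -- degree of the weight, the quantity of the induction.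
  have hpos : ∀ z, weight ε z = 0 → z = 0 := by
    rintro ⟨c, a⟩ hz
    rw [weight_apply, Prod.mk_eq_zero, Finsupp.degree_eq_zero_iff] at hz
    obtain ⟨rfl, hz⟩ := hz
    simpa using hz
  induction hN : (weight ε u).1 + (weight ε u).2.degree using Nat.strong_induction_on
    generalizing u v with
  | _ N ih =>
    by_cases hu : u = 0
    · subst hu
      rw [hpos v (by rw [← huv, map_zero])]
      exact Connected.refl _
    obtain ⟨u', v', z, hu', hv', hz, hzu, hzv⟩ := h u v huv hu
    obtain ⟨a, rfl⟩ := exists_add_of_le hzu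
    obtain ⟨b, rfl⟩ := exists_add_of_le hzv
    refine hu'.trans (Connected.trans ?_ hv'.symm)
    have hab : weight ε a = weight ε b := by
      have := (hu'.1.symm.trans huv).trans hv'.1
      rwa [map_add, map_add, add_right_inj] at this
    refine Connected.add_left (ih _ ?_ a b hab rfl) z
    rw [← hN, hu'.1, map_add, Prod.fst_add, Prod.snd_add, map_add]
    have : (weight ε z).1 + (weight ε z).2.degree ≠ 0 := fun h0 => hz <| hpos z <| by
      rw [Nat.add_eq_zero_iff, Finsupp.degree_eq_zero_iff] at h0
      exact Prod.ext h0.1 h0.2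
    omega

/-- If exponents of equal weight are connected, then modulo `L` every `T`-homogeneous polynomial
is a combination of monomials of pairwise distinct weights. -/
lemma exists_normal_form (h : ∀ u v, weight ε u = weight ε v → Connected m ε L u v) {k : ℕ}
    {p : MvPolynomial E (MvPolynomial ι K)} (hp : p.IsHomogeneous k) :
    ∃ c : {u : (E →₀ ℕ) × (ι →₀ ℕ) // u.1.degree = k} →₀ K,
      Set.InjOn (fun u : {u : (E →₀ ℕ) × (ι →₀ ℕ) // u.1.degree = k} => (weight ε u.1).2)
        (c.support : Set {u : (E →₀ ℕ) × (ι →₀ ℕ) // u.1.degree = k}) ∧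
      p - c.sum (fun u r => r • mon K u.1) ∈ L := by
  -- One representative exponent is chosen for each attained weight.
  set rep : ℕ × (ι →₀ ℕ) → (E →₀ ℕ) × (ι →₀ ℕ) := Function.invFun (weight ε) with hrep
  have hrepw : ∀ u, weight ε (rep (weight ε u)) = weight ε u := fun u =>
    Function.invFun_eq ⟨u, rfl⟩
  set Rk : Set {u : (E →₀ ℕ) × (ι →₀ ℕ) // u.1.degree = k} :=
    {u | rep (weight ε u.1) = u.1} with hRk
  set N : Submodule K (MvPolynomial E (MvPolynomial ι K)) :=
    L.restrictScalars K ⊔ Submodule.span K ((fun u => mon K u.1) '' Rk) with hN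
  -- Well-founded induction along the term order: replacing a monomial by its representative costs
  -- only smaller ones of the same T-degree.
  have key : ∀ (s : m.syn) (u : (E →₀ ℕ) × (ι →₀ ℕ)), m.toSyn (weight ε u).2 = s →
      u.1.degree = k → mon K u ∈ N := by
    intro s
    induction s using WellFoundedLT.induction with
    | _ s ih =>
      intro u hus huk
      have hle : remainders m ε L (weight ε u) ≤ N := by
        refine sup_le le_sup_left (Submodule.span_le.2 ?_)
        rintro _ ⟨v, ⟨h1, h2⟩, rfl⟩
        exact ih _ (hus ▸ h2) v rfl (h1.trans huk)
      have h1 := hle (h u (rep (weight ε u)) (hrepw u).symm).2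
      have h2 : mon K (rep (weight ε u)) ∈ N := by
        refine Submodule.mem_sup_right (Submodule.subset_span ⟨⟨rep (weight ε u), ?_⟩, ?_, rfl⟩)
        · exact (congrArg Prod.fst (hrepw u)).trans huk
        · exact congrArg rep (hrepw u)
      simpa using N.add_mem h1 h2
  have hpN : p ∈ N := by
    refine (Submodule.span_le.2 ?_) (mem_span_mon_of_isHomogeneous hp)
    rintro _ ⟨u, hu, rfl⟩
    exact key _ u rfl hu
  obtain ⟨l, hl, q, hq, rfl⟩ := Submodule.mem_sup.1 hpN
  obtain ⟨c, hc, rfl⟩ := (Finsupp.mem_span_image_iff_linearCombination K).1 hq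
  refine ⟨c, fun u hu v hv huv => Subtype.ext ?_, ?_⟩
  · have hu' : rep (weight ε u.1) = u.1 := (Finsupp.mem_supported K c).1 hc hu
    have hv' : rep (weight ε v.1) = v.1 := (Finsupp.mem_supported K c).1 hc hv
    have : weight ε u.1 = weight ε v.1 := Prod.ext (u.2.trans v.2.symm) huv
    rw [← hu', ← hv', this]
  · rw [Finsupp.linearCombination_apply, add_sub_cancel_right]
    exact hl

/-- A nontrivial combination of polynomials with pairwise distinct initial monomials is nonzero,
and its initial monomial is one of them. -/
lemma degree_sum_of_injOn {A : Type*} {c : A →₀ K} {g : A → MvPolynomial ι K}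
    (hg : ∀ a, g a ≠ 0) (hinj : Set.InjOn (fun a => m.degree (g a)) (c.support : Set A))
    (hc : c ≠ 0) : c.sum (fun a r => r • g a) ≠ 0 ∧
      ∃ a ∈ c.support, m.degree (c.sum fun a r => r • g a) = m.degree (g a) := by
  obtain ⟨a, ha, hmax⟩ := c.support.exists_max_image (fun a => m.toSyn (m.degree (g a)))
    (Finsupp.support_nonempty_iff.2 hc)
  -- The largest initial monomial occurs in no other summand, so it survives.
  have hcoeff : coeff (m.degree (g a)) (c.sum fun a r => r • g a) ≠ 0 := by
    rw [Finsupp.sum, coeff_sum, Finset.sum_eq_single_of_mem a ha]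
    · rw [coeff_smul, smul_eq_mul]
      exact mul_ne_zero (Finsupp.mem_support_iff.1 ha) (m.coeff_degree_ne_zero_iff.2 (hg a))
    · intro b hb hba
      rw [coeff_smul, m.coeff_eq_zero_of_lt, smul_zero]
      refine lt_of_le_of_ne (hmax b hb) fun h => hba (hinj hb ha (m.toSyn.injective h))
  refine ⟨fun h => hcoeff (by rw [h, coeff_zero]), a, ha, m.toSyn.injective (le_antisymm ?_ ?_)⟩
  · refine (m.degree_sum_le).trans (Finset.sup_le fun b hb => ?_)
    exact (m.degree_smul_le).trans (hmax b hb)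
  · exact m.le_degree (mem_support_iff.2 hcoeff)

variable {f : E → MvPolynomial ι K}

lemma eval_base_smul (r : K) (p : MvPolynomial E (MvPolynomial ι K)) :
    eval f (r • p) = r • eval f p := by
  rw [Algebra.smul_def, Algebra.smul_def, map_mul, MvPolynomial.algebraMap_apply, eval_C]

lemma eval_mon (u : (E →₀ ℕ) × (ι →₀ ℕ)) :
    eval f (mon K u) = monomial u.2 1 * u.1.prod fun e k => f e ^ k := by
  rw [mon, eval_monomial]

lemma eval_mon_ne_zero (hf : ∀ e, f e ≠ 0) (u : (E →₀ ℕ) × (ι →₀ ℕ)) :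
    eval f (mon K u) ≠ 0 := by
  rw [eval_mon]
  refine mul_ne_zero (by simp) (Finset.prod_ne_zero_iff.2 fun e _ => pow_ne_zero _ (hf e))

/-- Initial exponents are additive on products; the weight is designed to record them. -/
lemma degree_eval_mon (hf : ∀ e, f e ≠ 0) (u : (E →₀ ℕ) × (ι →₀ ℕ)) :
    m.degree (eval f (mon K u)) = (weight (fun e => m.degree (f e)) u).2 := by
  classical
  rw [eval_mon, Finsupp.prod, m.degree_mul (by simp)
    (Finset.prod_ne_zero_iff.2 fun e _ => pow_ne_zero _ (hf e)),
    m.degree_prod fun e _ => pow_ne_zero _ (hf e), m.degree_monomial, if_neg one_ne_zero,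
    weight_apply, Finsupp.linearCombination_apply, Finsupp.sum]
  simp only [m.degree_pow]

/-- The value of p is that of its normal form modulo L. Either the normal form is empty, so p lies
in L, or its terms have distinct initial monomials and the largest one survives. -/
lemma eval_eq_zero_or_exists_degree (hf : ∀ e, f e ≠ 0)
    (h : ∀ u v, weight (fun e => m.degree (f e)) u = weight (fun e => m.degree (f e)) v →
      Connected m (fun e => m.degree (f e)) L u v)
    (hL : L ≤ RingHom.ker (reesHom f)) {k : ℕ} {p : MvPolynomial E (MvPolynomial ι K)}
    (hp : p.IsHomogeneous k) :
    (eval f p = 0 ∧ p ∈ L) ∨ (eval f p ≠ 0 ∧ ∃ u : (E →₀ ℕ) × (ι →₀ ℕ),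
      weight (fun e => m.degree (f e)) u = (k, m.degree (eval f p))) := by
  obtain ⟨c, hinj, hc⟩ := exists_normal_form h hp
  have hq : (c.sum fun u r => r • mon K u.1).IsHomogeneous k :=
    (homogeneousSubmodule E (MvPolynomial ι K) k).sum_mem fun u _ => by
      change c u • mon K u.1 ∈ homogeneousSubmodule E (MvPolynomial ι K) k
      rw [← algebraMap_smul (MvPolynomial ι K)]
      exact Submodule.smul_mem _ _ (isHomogeneous_monomial _ u.2)
  have hev : eval f p = c.sum fun u r => r • eval f (mon K u.1) := by
    have h0 : eval f (p - c.sum fun u r => r • mon K u.1) = 0 :=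
      (reesHom_eq_zero_iff f (hp.sub hq)).1 (hL hc)
    rw [map_sub, sub_eq_zero] at h0
    rw [h0, Finsupp.sum, map_sum]
    exact Finset.sum_congr rfl fun u _ => eval_base_smul _ _
  by_cases hc0 : c = 0
  · left
    subst hc0
    exact ⟨by simpa using hev, by simpa using hc⟩
  · right
    obtain ⟨h1, u, _, h2⟩ := degree_sum_of_injOn (m := m)
      (g := fun u : {u : (E →₀ ℕ) × (ι →₀ ℕ) // u.1.degree = k} => eval f (mon K u.1))
      (fun u => eval_mon_ne_zero hf u.1)
      (fun u hu v hv huv => hinj hu hv (by simpa only [degree_eval_mon hf] using huv)) hc0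
    rw [hev]
    refine ⟨h1, u.1, Prod.ext u.2 ?_⟩
    rw [h2, degree_eval_mon hf]

/-- If exponents of equal weight are connected modulo `L ⊆ ker`, then `L` is the whole kernel. -/
lemma ker_reesHom_le_of_connected (hf : ∀ e, f e ≠ 0)
    (h : ∀ u v, weight (fun e => m.degree (f e)) u = weight (fun e => m.degree (f e)) v →
      Connected m (fun e => m.degree (f e)) L u v)
    (hL : L ≤ RingHom.ker (reesHom f)) : RingHom.ker (reesHom f) ≤ L := by
  refine ker_reesHom_le fun k p hp h0 => ?_
  rcases eval_eq_zero_or_exists_degree hf h hL hp with h1 | h1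
  · exact h1.2
  · exact absurd h0 h1.1

/-- If exponents of equal weight are connected, then the initial monomials of the powers of the
ideal are products of those of the generators. -/
lemma exists_weight_eq_of_mem_pow (hf : ∀ e, f e ≠ 0)
    (h : ∀ u v, weight (fun e => m.degree (f e)) u = weight (fun e => m.degree (f e)) v →
      Connected m (fun e => m.degree (f e)) L u v)
    (hL : L ≤ RingHom.ker (reesHom f)) {k : ℕ} {g : MvPolynomial ι K} (hg0 : g ≠ 0)
    (hg : g ∈ Ideal.span (Set.range f) ^ k) : ∃ u : (E →₀ ℕ) × (ι →₀ ℕ),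
      weight (fun e => m.degree (f e)) u = (k, m.degree g) := by
  obtain ⟨p, hp, rfl⟩ := (Ideal.mem_span_pow_iff_exists_isHomogeneous f g).1 hg
  rcases eval_eq_zero_or_exists_degree hf h hL hp with h1 | h1
  · exact absurd h1.1 hg0
  · exact h1.2

end Lifting

/-! ### Initial monomials of binomial edge ideals -/

section Edges

variable {n : ℕ}

/-- The edges `{i, j}` of `G`, as pairs with `i < j`. -/
abbrev OrderedEdge (G : SimpleGraph (Fin n)) : Type :=
  {e : Fin n × Fin n // e.1 < e.2 ∧ G.Adj e.1 e.2}

/-- The exponent of `x_i`. -/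
abbrev xExp (i : Fin n) : Var n →₀ ℕ := Finsupp.single (Sum.inlₗ i) 1

/-- The exponent of `y_i`. -/
abbrev yExp (i : Fin n) : Var n →₀ ℕ := Finsupp.single (Sum.inrₗ i) 1

variable {G : SimpleGraph (Fin n)}

/-- The exponent of the initial monomial `x_i y_j` of `f_e`, where `e = {i, j}` with `i < j`. -/
def edgeExp (e : OrderedEdge G) : Var n →₀ ℕ := xExp e.1.1 + yExp e.1.2

/-- The generator `f_e`. -/
def edgeGen (K : Type*) [Field K] (e : OrderedEdge G) : MvPolynomial (Var n) K :=
  edgeBinomial K e.1.1 e.1.2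

lemma var_cases (s : Var n) : (∃ i, s = Sum.inlₗ i) ∨ ∃ i, s = Sum.inrₗ i := by
  rcases h : ofLex s with i | i
  · exact Or.inl ⟨i, h⟩
  · exact Or.inr ⟨i, h⟩

lemma inl_ne_inr (i j : Fin n) : (Sum.inlₗ i : Var n) ≠ Sum.inrₗ j :=
  fun h => Sum.inl_ne_inr (toLex.injective h)

lemma edgeExp_inl {e : OrderedEdge G} {i : Fin n} :
    edgeExp e (Sum.inlₗ i) ≠ 0 ↔ e.1.1 = i := by
  simp [edgeExp, Finsupp.single_apply]

lemma edgeExp_inr {e : OrderedEdge G} {j : Fin n} :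
    edgeExp e (Sum.inrₗ j) ≠ 0 ↔ e.1.2 = j := by
  simp [edgeExp, Finsupp.single_apply]

/-- The comparison is decided at x_b, whatever the y's are. Every drop in weight below reduces to
it. -/
lemma sigma_lt {a b : Fin n} (h : b < a) (c d : Fin n) :
    xExp a + yExp d ≺[sigma n] xExp b + yExp c := by
  rw [sigma, MonomialOrder.lex_lt_iff, Finsupp.Lex.lt_iff]
  refine ⟨Sum.inlₗ b, fun s hs => ?_, ?_⟩
  · rcases var_cases s with ⟨i, rfl⟩ | ⟨i, rfl⟩
    · have hi : i < b := Sum.Lex.inl_lt_inl_iff.1 hs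
      simp [hi.ne', (hi.trans h).ne']
    · exact absurd hs (Sum.Lex.not_inr_lt_inl)
  · simp [h.ne']

variable (K : Type*) [Field K]

lemma edgeBinomial_eq (i j : Fin n) :
    edgeBinomial K i j = monomial (xExp i + yExp j) 1 - monomial (xExp j + yExp i) 1 := by
  simp only [edgeBinomial, x, y, X, monomial_mul, one_mul]

lemma degree_edgeBinomial {i j : Fin n} (h : i < j) :
    (sigma n).degree (edgeBinomial K i j) = xExp i + yExp j := by
  classical
  rw [edgeBinomial_eq, MonomialOrder.degree_sub_of_lt] <;>
    simp only [MonomialOrder.degree_monomial, one_ne_zero, if_false]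
  exact sigma_lt h _ _

lemma edgeBinomial_ne_zero {i j : Fin n} (h : i < j) : edgeBinomial K i j ≠ 0 := by
  refine (sigma n).ne_zero_of_degree_ne_zero ?_
  rw [degree_edgeBinomial K h]
  simp

lemma edgeGen_ne_zero (e : OrderedEdge G) : edgeGen K e ≠ 0 := edgeBinomial_ne_zero K e.2.1

lemma degree_edgeGen (e : OrderedEdge G) : (sigma n).degree (edgeGen K e) = edgeExp e :=
  degree_edgeBinomial K e.2.1

lemma range_edgeGen : Set.range (edgeGen K : OrderedEdge G → _) = edgeBinomials K G := by
  ext f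
  constructor
  · rintro ⟨e, rfl⟩
    exact ⟨_, _, e.2.1, e.2.2, rfl⟩
  · rintro ⟨i, j, h, ha, rfl⟩
    exact ⟨⟨(i, j), h, ha⟩, rfl⟩

lemma initialMonomials_edgeBinomials :
    initialMonomials (sigma n) (edgeBinomials K G) =
      (fun a => monomial a (1 : K)) '' Set.range (edgeExp : OrderedEdge G → _) := by
  ext q
  constructor
  · rintro ⟨f, hf, _, rfl⟩
    rw [← range_edgeGen] at hf
    obtain ⟨e, rfl⟩ := hf
    exact ⟨_, ⟨e, rfl⟩, by rw [degree_edgeGen]⟩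
  · rintro ⟨_, ⟨e, rfl⟩, rfl⟩
    exact ⟨edgeGen K e, by rw [← range_edgeGen]; exact ⟨e, rfl⟩, edgeGen_ne_zero K e,
      by rw [degree_edgeGen]⟩

variable {K}

/-! ### The combinatorics of closed labellings -/

/-- By the Gröbner property the initial ideal is generated by the x_i y_j of the edges, and
membership in a monomial ideal is divisibility. -/
lemma IsClosedLabelling.exists_edgeExp_le (hG : IsClosedLabelling K G)
    {f : MvPolynomial (Var n) K} (hf : f ∈ binomialEdgeIdeal K G) (hf0 : f ≠ 0) :
    ∃ e : OrderedEdge G, edgeExp e ≤ (sigma n).degree f := by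
  classical
  have h : monomial ((sigma n).degree f) (1 : K) ∈
      initialIdeal (sigma n) (binomialEdgeIdeal K G) :=
    Ideal.subset_span ⟨f, hf, hf0, rfl⟩
  rw [← hG.2, initialMonomials_edgeBinomials, mem_ideal_span_monomial_image] at h
  obtain ⟨_, ⟨e, rfl⟩, he⟩ := h ((sigma n).degree f) (by simp)
  exact ⟨e, he⟩

lemma apply_ne_zero_of_edgeExp_le {e : OrderedEdge G} {a : Var n →₀ ℕ} (h : edgeExp e ≤ a) :
    a (Sum.inlₗ e.1.1) ≠ 0 ∧ a (Sum.inrₗ e.1.2) ≠ 0 := by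
  have h1 := h (Sum.inlₗ e.1.1)
  have h2 := h (Sum.inrₗ e.1.2)
  have h3 := edgeExp_inl.2 (rfl : e.1.1 = e.1.1)
  have h4 := edgeExp_inr.2 (rfl : e.1.2 = e.1.2)
  omega

lemma edgeBinomial_mem {i j : Fin n} (h : i < j) (ha : G.Adj i j) :
    edgeBinomial K i j ∈ binomialEdgeIdeal K G :=
  Ideal.subset_span ⟨i, j, h, ha, rfl⟩

/-- In a closed labelling, larger neighbours of a vertex are adjacent. -/
lemma IsClosedLabelling.adj_of_common_left (hG : IsClosedLabelling K G) {i j k : Fin n}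
    (hij : i < j) (hjk : j < k) (aij : G.Adj i j) (aik : G.Adj i k) : G.Adj j k := by
  -- The initial monomial y_i x_j y_k must be divisible by x_a y_b for an edge a < b. So a = j, and
  -- b = i is excluded by i < j.
  have hmem : y K i * edgeBinomial K j k ∈ binomialEdgeIdeal K G := by
    have : y K i * edgeBinomial K j k =
        y K j * edgeBinomial K i k - y K k * edgeBinomial K i j := by
      simp only [edgeBinomial]; ring
    rw [this]
    exact Ideal.sub_mem _ (Ideal.mul_mem_left _ _ (edgeBinomial_mem (hij.trans hjk) aik))
      (Ideal.mul_mem_left _ _ (edgeBinomial_mem hij aij))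
  have hy : y K i ≠ 0 := X_ne_zero _
  obtain ⟨e, he⟩ := hG.exists_edgeExp_le hmem (mul_ne_zero hy (edgeBinomial_ne_zero K hjk))
  rw [MonomialOrder.degree_mul hy (edgeBinomial_ne_zero K hjk), degree_edgeBinomial K hjk, y,
    MonomialOrder.degree_X] at he
  obtain ⟨h1, h2⟩ := apply_ne_zero_of_edgeExp_le he
  simp [Finsupp.single_apply, imp_iff_or_not] at h1 h2
  have h3 := e.2
  rw [← h1] at h3
  rcases h2 with h2 | h2
  · rw [← h2] at h3
    exact h3.2
  · rw [← h2] at h3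
    exact absurd (h3.1.trans hij) (lt_irrefl _)

/-- In a closed labelling, smaller neighbours of a vertex are adjacent. -/
lemma IsClosedLabelling.adj_of_common_right (hG : IsClosedLabelling K G) {i j k : Fin n}
    (hij : i < j) (hjk : j < k) (aik : G.Adj i k) (ajk : G.Adj j k) : G.Adj i j := by
  -- Here x_k x_i y_j is divisible by x_a y_b for an edge a < b. So b = j, and a = k is excluded by
  -- j < k.
  have hmem : x K k * edgeBinomial K i j ∈ binomialEdgeIdeal K G := by
    have : x K k * edgeBinomial K i j =
        x K j * edgeBinomial K i k - x K i * edgeBinomial K j k := by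
      simp only [edgeBinomial]; ring
    rw [this]
    exact Ideal.sub_mem _ (Ideal.mul_mem_left _ _ (edgeBinomial_mem (hij.trans hjk) aik))
      (Ideal.mul_mem_left _ _ (edgeBinomial_mem hjk ajk))
  have hx : x K k ≠ 0 := X_ne_zero _
  obtain ⟨e, he⟩ := hG.exists_edgeExp_le hmem (mul_ne_zero hx (edgeBinomial_ne_zero K hij))
  rw [MonomialOrder.degree_mul hx (edgeBinomial_ne_zero K hij), degree_edgeBinomial K hij, x,
    MonomialOrder.degree_X] at he
  obtain ⟨h1, h2⟩ := apply_ne_zero_of_edgeExp_le he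
  simp [Finsupp.single_apply, imp_iff_or_not] at h1 h2
  have h3 := e.2
  rw [← h2] at h3
  rcases h1 with h1 | h1
  · rw [← h1] at h3
    exact h3.2
  · rw [← h1] at h3
    exact absurd (h3.1.trans hjk) (lt_irrefl _)

/-! ### Lifting the relations between the initial monomials -/

/-- The exponent of the variable `T_e`. -/
def edgeVar (e : OrderedEdge G) : (OrderedEdge G →₀ ℕ) × (Var n →₀ ℕ) :=
  (Finsupp.single e 1, 0)

/-- The exponent of the variable `x_i`. -/
def xVar (G : SimpleGraph (Fin n)) (i : Fin n) : (OrderedEdge G →₀ ℕ) × (Var n →₀ ℕ) :=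
  (0, xExp i)

/-- The exponent of the variable `y_i`. -/
def yVar (G : SimpleGraph (Fin n)) (i : Fin n) : (OrderedEdge G →₀ ℕ) × (Var n →₀ ℕ) :=
  (0, yExp i)

lemma weight_edgeVar (e : OrderedEdge G) : weight edgeExp (edgeVar e) = (1, edgeExp e) := by
  simp [edgeVar, weight_apply]

lemma weight_xVar (i : Fin n) : weight edgeExp (xVar G i) = (0, xExp i) := by
  simp [xVar, weight_apply]

lemma weight_yVar (i : Fin n) : weight edgeExp (yVar G i) = (0, yExp i) := by
  simp [yVar, weight_apply]

lemma eval_mon_edgeVar (e : OrderedEdge G) :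
    eval (edgeGen K) (mon K (edgeVar e)) = edgeBinomial K e.1.1 e.1.2 := by
  simp [edgeVar, eval_mon, edgeGen]

lemma eval_mon_xVar (i : Fin n) : eval (edgeGen K) (mon K (xVar G i)) = x K i := by
  simp [xVar, eval_mon, x, X]

lemma eval_mon_yVar (i : Fin n) : eval (edgeGen K) (mon K (yVar G i)) = y K i := by
  simp [yVar, eval_mon, y, X]

variable (K G) in
/-- Exponents are linked if they are connected modulo the relations of degree at most two. -/
abbrev Linked (u v : (OrderedEdge G →₀ ℕ) × (Var n →₀ ℕ)) : Prop :=
  Connected (sigma n) edgeExp (relationsUpTo (edgeGen K : OrderedEdge G → _) 2) u v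

/-- If f-values satisfy u - v = z with z of smaller weight, then u - v - z is itself a relation of
degree at most 2. Links thus reduce to polynomial identities in S. -/
lemma linked_of_eval_eq {u v : (OrderedEdge G →₀ ℕ) × (Var n →₀ ℕ)}
    {z : MvPolynomial (OrderedEdge G) (MvPolynomial (Var n) K)}
    (h : weight edgeExp u = weight edgeExp v) (h2 : (weight edgeExp u).1 ≤ 2)
    (hz : z ∈ Submodule.span K (mon K '' {r | (weight edgeExp r).1 = (weight edgeExp u).1 ∧
      (weight edgeExp r).2 ≺[sigma n] (weight edgeExp u).2}))
    (he : eval (edgeGen K) (mon K u) - eval (edgeGen K) (mon K v) = eval (edgeGen K) z) :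
    Linked G K u v := by
  refine ⟨h, ?_⟩
  have hzh : z.IsHomogeneous (weight edgeExp u).1 := by
    have : Submodule.span K (mon K '' {r | (weight edgeExp r).1 = (weight edgeExp u).1 ∧
        (weight edgeExp r).2 ≺[sigma n] (weight edgeExp u).2}) ≤
        (homogeneousSubmodule (OrderedEdge G) (MvPolynomial (Var n) K)
          (weight edgeExp u).1).restrictScalars K := by
      refine Submodule.span_le.2 ?_
      rintro _ ⟨r, hr, rfl⟩
      exact hr.1 ▸ mon_isHomogeneous edgeExp r
    exact this hz
  rw [← sub_add_cancel (mon K u - mon K v) z]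
  refine Submodule.add_mem _ (mem_remainders_of_mem (mem_relationsUpTo _ h2
    (((mon_isHomogeneous edgeExp u).sub ?_).sub hzh) ?_)) (Submodule.mem_sup_right hz)
  · rw [h]
    exact mon_isHomogeneous edgeExp v
  · rw [map_sub, map_sub, he, sub_self]

lemma sigma_add_lt {a b : Var n →₀ ℕ} (c : Var n →₀ ℕ) (h : a ≺[sigma n] b) :
    c + a ≺[sigma n] c + b := by
  rw [map_add, map_add]
  exact add_lt_add_right h _

lemma sigma_lt_of_add {a b a' b' : Var n →₀ ℕ} (c : Var n →₀ ℕ) (h : a ≺[sigma n] b)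
    (ha : a' = c + a) (hb : b' = c + b) : a' ≺[sigma n] b' := by
  subst ha hb
  exact sigma_add_lt c h

/-- The syzygy x_i f_{kj} - x_k f_{ij} = -x_j f_{ik}; closedness makes {i, k} an edge. -/
lemma linked_x_of_lt (hG : IsClosedLabelling K G) {i j k : Fin n} (hik : i < k) (hkj : k < j)
    (aij : G.Adj i j) (akj : G.Adj k j) :
    Linked G K (xVar G i + edgeVar ⟨(k, j), hkj, akj⟩)
      (xVar G k + edgeVar ⟨(i, j), hik.trans hkj, aij⟩) := by
  have aik := hG.adj_of_common_right hik hkj aij akj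
  refine linked_of_eval_eq (z := -mon K (xVar G j + edgeVar ⟨(i, k), hik, aik⟩)) ?_ ?_
    (Submodule.neg_mem _ (Submodule.subset_span ⟨_, ⟨?_, ?_⟩, rfl⟩)) ?_
  · simp only [map_add, weight_xVar, weight_edgeVar, edgeExp, Prod.mk_add_mk]
    congr 1
    abel
  · simp [weight_xVar, weight_edgeVar]
  · simp [weight_xVar, weight_edgeVar]
  · simp only [map_add (weight edgeExp), weight_xVar, weight_edgeVar, edgeExp, Prod.mk_add_mk]
    exact sigma_lt_of_add (xExp i) (sigma_lt hkj j k) (by abel) (by abel)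
  · simp only [map_neg, mon_add, map_mul, eval_mon_xVar, eval_mon_edgeVar, edgeBinomial]
    ring

lemma linked_x (hG : IsClosedLabelling K G) {i j k : Fin n} (hij : i < j) (hkj : k < j)
    (aij : G.Adj i j) (akj : G.Adj k j) :
    Linked G K (xVar G i + edgeVar ⟨(k, j), hkj, akj⟩) (xVar G k + edgeVar ⟨(i, j), hij, aij⟩) := by
  rcases lt_trichotomy i k with h | rfl | h
  · exact linked_x_of_lt hG h hkj aij akj
  · exact Connected.refl _
  · exact (linked_x_of_lt hG h hij akj aij).symm

/-- The syzygy y_j f_{il} - y_l f_{ij} = y_i f_{jl}; closedness makes {j, l} an edge. -/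
lemma linked_y_of_lt (hG : IsClosedLabelling K G) {i j l : Fin n} (hij : i < j) (hjl : j < l)
    (aij : G.Adj i j) (ail : G.Adj i l) :
    Linked G K (yVar G j + edgeVar ⟨(i, l), hij.trans hjl, ail⟩)
      (yVar G l + edgeVar ⟨(i, j), hij, aij⟩) := by
  have ajl := hG.adj_of_common_left hij hjl aij ail
  refine linked_of_eval_eq (z := mon K (yVar G i + edgeVar ⟨(j, l), hjl, ajl⟩)) ?_ ?_
    (Submodule.subset_span ⟨_, ⟨?_, ?_⟩, rfl⟩) ?_
  · simp only [map_add, weight_yVar, weight_edgeVar, edgeExp, Prod.mk_add_mk]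
    congr 1
    abel
  · simp [weight_yVar, weight_edgeVar]
  · simp [weight_yVar, weight_edgeVar]
  · simp only [map_add (weight edgeExp), weight_yVar, weight_edgeVar, edgeExp, Prod.mk_add_mk]
    exact sigma_lt_of_add (yExp l) (sigma_lt hij j i) (by abel) (by abel)
  · simp only [mon_add, map_mul, eval_mon_yVar, eval_mon_edgeVar, edgeBinomial]
    ring

lemma linked_y (hG : IsClosedLabelling K G) {i j l : Fin n} (hij : i < j) (hil : i < l)
    (aij : G.Adj i j) (ail : G.Adj i l) :
    Linked G K (yVar G j + edgeVar ⟨(i, l), hil, ail⟩) (yVar G l + edgeVar ⟨(i, j), hij, aij⟩) := by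
  rcases lt_trichotomy j l with h | rfl | h
  · exact linked_y_of_lt hG hij h aij ail
  · exact Connected.refl _
  · exact (linked_y_of_lt hG hil h ail aij).symm

/-- Expand f_e f_{e'} = f_{e'} f_e into initial terms and tails; the tails have smaller weight. No
closedness is needed. -/
lemma linked_koszul (e e' : OrderedEdge G) :
    Linked G K (xVar G e.1.1 + yVar G e.1.2 + edgeVar e')
      (xVar G e'.1.1 + yVar G e'.1.2 + edgeVar e) := by
  obtain ⟨⟨i, j⟩, hij, aij⟩ := e
  obtain ⟨⟨k, l⟩, hkl, akl⟩ := e'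
  refine linked_of_eval_eq (z := mon K (xVar G j + yVar G i + edgeVar ⟨(k, l), hkl, akl⟩) -
    mon K (xVar G l + yVar G k + edgeVar ⟨(i, j), hij, aij⟩)) ?_ ?_
    (Submodule.sub_mem _ (Submodule.subset_span ⟨_, ⟨?_, ?_⟩, rfl⟩)
      (Submodule.subset_span ⟨_, ⟨?_, ?_⟩, rfl⟩)) ?_
  · simp only [map_add, weight_xVar, weight_yVar, weight_edgeVar, edgeExp, Prod.mk_add_mk]
    congr 1
    abel
  · simp [weight_xVar, weight_yVar, weight_edgeVar]
  · simp [weight_xVar, weight_yVar, weight_edgeVar]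
  · simp only [map_add (weight edgeExp), weight_xVar, weight_yVar, weight_edgeVar, edgeExp,
      Prod.mk_add_mk]
    exact sigma_lt_of_add (xExp k + yExp l) (sigma_lt hij j i) (by abel) (by abel)
  · simp [weight_xVar, weight_yVar, weight_edgeVar]
  · simp only [map_add (weight edgeExp), weight_xVar, weight_yVar, weight_edgeVar, edgeExp,
      Prod.mk_add_mk]
    exact sigma_lt_of_add (xExp i + yExp j) (sigma_lt hkl l k) (by abel) (by abel)
  · simp only [map_sub, mon_add, map_mul, eval_mon_xVar, eval_mon_yVar, eval_mon_edgeVar,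
      edgeBinomial]
    ring

/-- The Plücker relation f_{ik} f_{lj} - f_{ij} f_{lk} = -f_{il} f_{jk}, the only move of T-degree
2. Closedness makes {i, l} and {j, k} edges. -/
lemma linked_swap (hG : IsClosedLabelling K G) {i j l k : Fin n} (hil : i < l) (hlj : l < j)
    (hjk : j < k) (aij : G.Adj i j) (aik : G.Adj i k) (alj : G.Adj l j) (alk : G.Adj l k) :
    Linked G K
      (edgeVar ⟨(i, k), (hil.trans hlj).trans hjk, aik⟩ + edgeVar ⟨(l, j), hlj, alj⟩)
      (edgeVar ⟨(i, j), hil.trans hlj, aij⟩ + edgeVar ⟨(l, k), hlj.trans hjk, alk⟩) := by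
  have ail := hG.adj_of_common_right hil hlj aij alj
  have ajk := hG.adj_of_common_left (hil.trans hlj) hjk aij aik
  refine linked_of_eval_eq
    (z := -mon K (edgeVar ⟨(i, l), hil, ail⟩ + edgeVar ⟨(j, k), hjk, ajk⟩)) ?_ ?_
    (Submodule.neg_mem _ (Submodule.subset_span ⟨_, ⟨?_, ?_⟩, rfl⟩)) ?_
  · simp only [map_add, weight_edgeVar, edgeExp, Prod.mk_add_mk]
    congr 1
    abel
  · simp [weight_edgeVar]
  · simp [weight_edgeVar]
  · simp only [map_add (weight edgeExp), weight_edgeVar, edgeExp, Prod.mk_add_mk]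
    exact sigma_lt_of_add (xExp i + yExp k) (sigma_lt hlj j l) (by abel) (by abel)
  · simp only [map_neg, mon_add, map_mul, eval_mon_edgeVar, edgeBinomial]
    ring

end Edges

/-! ### Connectedness of monomials of equal weight -/

section Connectivity

variable {n : ℕ} {G : SimpleGraph (Fin n)} {K : Type*} [Field K]

lemma weight_snd_ne_zero {u : (OrderedEdge G →₀ ℕ) × (Var n →₀ ℕ)} {s : Var n} :
    (weight edgeExp u).2 s ≠ 0 ↔ u.2 s ≠ 0 ∨ ∃ e, u.1 e ≠ 0 ∧ edgeExp e s ≠ 0 := by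
  rw [weight_apply, Finsupp.add_apply, Finsupp.linearCombination_apply, Finsupp.sum_apply,
    Finsupp.sum, Ne, Nat.add_eq_zero_iff, not_and_or, Finset.sum_eq_zero_iff]
  refine or_congr Iff.rfl ?_
  push Not
  refine exists_congr fun e => ?_
  rw [Finsupp.mem_support_iff, Finsupp.smul_apply, smul_eq_mul, mul_ne_zero_iff]
  tauto

lemma mk_le_iff {a : OrderedEdge G →₀ ℕ} {b : Var n →₀ ℕ}
    {u : (OrderedEdge G →₀ ℕ) × (Var n →₀ ℕ)} : (a, b) ≤ u ↔ a ≤ u.1 ∧ b ≤ u.2 := Iff.rfl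

lemma edgeVar_ne_zero (e : OrderedEdge G) : edgeVar e ≠ 0 := by
  simp [edgeVar]

lemma edgeVar_le {u : (OrderedEdge G →₀ ℕ) × (Var n →₀ ℕ)} {e : OrderedEdge G} :
    edgeVar e ≤ u ↔ u.1 e ≠ 0 := by
  rw [edgeVar, mk_le_iff, Finsupp.single_le_iff,
    Nat.one_le_iff_ne_zero]
  simp

/-- A link between factors extends to the whole monomial by multiplying with the cofactor. -/
lemma le_of_linked {u a b z : (OrderedEdge G →₀ ℕ) × (Var n →₀ ℕ)} (hab : Linked G K a b)
    (ha : a ≤ u) (hz : z ≤ b) : ∃ u', Linked G K u u' ∧ z ≤ u' := by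
  obtain ⟨d, rfl⟩ := exists_add_of_le ha
  refine ⟨d + b, ?_, hz.trans le_add_self⟩
  rw [add_comm a]
  exact hab.add_left d

lemma xVar_add_edgeVar_le {u : (OrderedEdge G →₀ ℕ) × (Var n →₀ ℕ)} {i : Fin n}
    {e : OrderedEdge G} (hi : u.2 (Sum.inlₗ i) ≠ 0) (he : u.1 e ≠ 0) :
    xVar G i + edgeVar e ≤ u := by
  rw [xVar, edgeVar, Prod.mk_add_mk, zero_add, add_zero, mk_le_iff,
    Finsupp.single_le_iff, Finsupp.single_le_iff]
  omega

lemma yVar_add_edgeVar_le {u : (OrderedEdge G →₀ ℕ) × (Var n →₀ ℕ)} {i : Fin n}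
    {e : OrderedEdge G} (hi : u.2 (Sum.inrₗ i) ≠ 0) (he : u.1 e ≠ 0) :
    yVar G i + edgeVar e ≤ u := by
  rw [yVar, edgeVar, Prod.mk_add_mk, zero_add, add_zero, mk_le_iff,
    Finsupp.single_le_iff, Finsupp.single_le_iff]
  omega

lemma xVar_add_yVar_add_edgeVar_le {u : (OrderedEdge G →₀ ℕ) × (Var n →₀ ℕ)} {i j : Fin n}
    {e : OrderedEdge G} (hi : u.2 (Sum.inlₗ i) ≠ 0) (hj : u.2 (Sum.inrₗ j) ≠ 0)
    (he : u.1 e ≠ 0) : xVar G i + yVar G j + edgeVar e ≤ u := by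
  rw [xVar, yVar, edgeVar, Prod.mk_add_mk, Prod.mk_add_mk, add_zero, zero_add, add_zero,
    mk_le_iff, Finsupp.single_le_iff]
  refine ⟨by omega, fun s => ?_⟩
  rw [Finsupp.add_apply, Finsupp.single_apply, Finsupp.single_apply]
  split_ifs with h1 h2 h2
  · exact absurd (h1.trans h2.symm) (inl_ne_inr i j)
  · subst h1; omega
  · subst h2; omega
  · exact Nat.zero_le _

lemma add_edgeVar_le {u : (OrderedEdge G →₀ ℕ) × (Var n →₀ ℕ)}
    {e e' : OrderedEdge G} (h : e ≠ e') (he : u.1 e ≠ 0) (he' : u.1 e' ≠ 0) :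
    edgeVar e + edgeVar e' ≤ u := by
  rw [edgeVar, edgeVar, Prod.mk_add_mk, add_zero, mk_le_iff]
  refine ⟨fun s => ?_, by simp⟩
  classical
  rw [Finsupp.add_apply, Finsupp.single_apply, Finsupp.single_apply]
  split_ifs with h1 h2 h2
  · exact absurd (h1.trans h2.symm) h
  · subst h1; omega
  · subst h2; omega
  · exact Nat.zero_le _

/-- An unmatched end of the edge `e` allows to move to an exponent containing `T_e`. -/
lemma exists_linked_edgeVar_le (hG : IsClosedLabelling K G)
    {u : (OrderedEdge G →₀ ℕ) × (Var n →₀ ℕ)} (hu : u.1 ≠ 0) (e : OrderedEdge G)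
    (h : u.2 (Sum.inlₗ e.1.1) ≠ 0 ∨ u.2 (Sum.inrₗ e.1.2) ≠ 0)
    (hx : (weight edgeExp u).2 (Sum.inlₗ e.1.1) ≠ 0)
    (hy : (weight edgeExp u).2 (Sum.inrₗ e.1.2) ≠ 0) :
    ∃ u', Linked G K u u' ∧ edgeVar e ≤ u' := by
  -- If both ends of e are unmatched, a Koszul move trades them against any T_{e'} in u. Otherwise
  -- the missing end belongs to some T_{e'} in u, and a linear syzygy exchanges the other ends.
  by_cases h2 : u.2 (Sum.inlₗ e.1.1) ≠ 0 ∧ u.2 (Sum.inrₗ e.1.2) ≠ 0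
  · obtain ⟨e', he'⟩ := Finsupp.ne_iff.1 hu
    exact le_of_linked (linked_koszul e e') (xVar_add_yVar_add_edgeVar_le h2.1 h2.2 he')
      le_add_self
  · obtain ⟨⟨i, j⟩, hij, aij⟩ := e
    rcases h with h | h
    · obtain ⟨⟨⟨k, l⟩, hkl, akl⟩, he', hl⟩ :=
        (weight_snd_ne_zero.1 hy).resolve_left fun h' => h2 ⟨h, h'⟩
      obtain rfl : l = j := edgeExp_inr.1 hl
      exact le_of_linked (linked_x hG hij hkl aij akl) (xVar_add_edgeVar_le h he') le_add_self
    · obtain ⟨⟨⟨k, l⟩, hkl, akl⟩, he', hk⟩ :=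
        (weight_snd_ne_zero.1 hx).resolve_left fun h' => h2 ⟨h', h⟩
      obtain rfl : k = i := edgeExp_inl.1 hk
      exact le_of_linked (linked_y hG hij hkl aij akl) (yVar_add_edgeVar_le h he') le_add_self

/-- If `u` has an unmatched vertex, it can be moved to share a variable with `v`. -/
lemma exists_common_of_unmatched (hG : IsClosedLabelling K G)
    {u v : (OrderedEdge G →₀ ℕ) × (Var n →₀ ℕ)} (huv : weight edgeExp u = weight edgeExp v)
    (h : u.2 ≠ 0) : ∃ u' z, Linked G K u u' ∧ z ≠ 0 ∧ z ≤ u' ∧ z ≤ v := by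
  obtain ⟨s, hs⟩ := Finsupp.ne_iff.1 h
  have hs : u.2 s ≠ 0 := hs
  have hw : (weight edgeExp v).2 s ≠ 0 := huv ▸ weight_snd_ne_zero.2 (Or.inl hs)
  -- The variable s is either unmatched in v too, hence common, or an end of an edge e of v, which
  -- is then moved into u.
  rcases weight_snd_ne_zero.1 hw with hv | ⟨e, he, hes⟩
  · refine ⟨u, (0, Finsupp.single s 1), Connected.refl _, by simp, ?_, ?_⟩
    · rw [mk_le_iff, Finsupp.single_le_iff]
      exact ⟨zero_le, by omega⟩
    · rw [mk_le_iff, Finsupp.single_le_iff]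
      exact ⟨zero_le, by omega⟩
  · have hu : u.1 ≠ 0 := by
      intro h0
      have h1 : u.1.degree = v.1.degree := congrArg Prod.fst huv
      rw [h0, map_zero, eq_comm, Finsupp.degree_eq_zero_iff] at h1
      exact he (by rw [h1]; rfl)
    obtain ⟨u', hu', hz⟩ := exists_linked_edgeVar_le hG hu e (by
      rcases var_cases s with ⟨i, rfl⟩ | ⟨i, rfl⟩
      · rw [edgeExp_inl.1 hes]; exact Or.inl hs
      · rw [edgeExp_inr.1 hes]; exact Or.inr hs)
      (huv ▸ weight_snd_ne_zero.2 (Or.inr ⟨e, he, edgeExp_inl.2 rfl⟩))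
      (huv ▸ weight_snd_ne_zero.2 (Or.inr ⟨e, he, edgeExp_inr.2 rfl⟩))
    exact ⟨u', _, hu', edgeVar_ne_zero e, hz, edgeVar_le.2 he⟩

/-- Two edges of a perfect matching can be swapped to contain a prescribed edge at the smallest
vertex. -/
lemma exists_linked_of_lt (hG : IsClosedLabelling K G)
    {v : (OrderedEdge G →₀ ℕ) × (Var n →₀ ℕ)} (hv : v.2 = 0) {i j k : Fin n}
    (hij : i < j) (hjk : j < k) (aij : G.Adj i j) (aik : G.Adj i k)
    (hmin : ∀ e : OrderedEdge G, v.1 e ≠ 0 → i ≤ e.1.1)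
    (hk : v.1 ⟨(i, k), hij.trans hjk, aik⟩ ≠ 0) (hj : (weight edgeExp v).2 (Sum.inrₗ j) ≠ 0) :
    ∃ v', Linked G K v v' ∧ edgeVar ⟨(i, j), hij, aij⟩ ≤ v' := by
  obtain ⟨⟨⟨l, j'⟩, hlj, alj⟩, he, hj'⟩ :=
    (weight_snd_ne_zero.1 hj).resolve_left fun h' => h' (by rw [hv]; rfl)
  obtain rfl : j' = j := edgeExp_inr.1 hj'
  rcases (hmin _ he).eq_or_lt with hil | hil
  · have hil : i = l := hil
    subst hil
    exact ⟨v, Connected.refl _, edgeVar_le.2 he⟩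
  · have hil : i < l := hil
    -- With i < l < j < k, the common neighbour j makes {i, l} an edge; then i is a common smaller
    -- neighbour of l and k, so {l, k} is an edge and the swap is available.
    have ail := hG.adj_of_common_right hil hlj aij alj
    have alk := hG.adj_of_common_left hil (hlj.trans hjk) ail aik
    refine le_of_linked (linked_swap hG hil hlj hjk aij aik alj alk)
      (add_edgeVar_le (fun h => ?_) hk he) le_self_add
    exact hil.ne (congrArg (fun e : OrderedEdge G => e.1.1) h)

/-- If nothing is unmatched on either side, equal weights force the same smallest left end i. Let i
be paired with j in u and with k in v; the side with the larger partner is swapped to use the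
smaller one. -/
lemma exists_common (hG : IsClosedLabelling K G)
    (u v : (OrderedEdge G →₀ ℕ) × (Var n →₀ ℕ)) (huv : weight edgeExp u = weight edgeExp v)
    (hu : u ≠ 0) :
    ∃ u' v' z, Linked G K u u' ∧ Linked G K v v' ∧ z ≠ 0 ∧ z ≤ u' ∧ z ≤ v' := by
  by_cases hu2 : u.2 = 0
  swap
  · obtain ⟨u', z, h1, h2, h3, h4⟩ := exists_common_of_unmatched hG huv hu2
    exact ⟨u', v, z, h1, Connected.refl _, h2, h3, h4⟩
  by_cases hv2 : v.2 = 0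
  swap
  · obtain ⟨v', z, h1, h2, h3, h4⟩ := exists_common_of_unmatched hG huv.symm hv2
    exact ⟨u, v', z, Connected.refl _, h1, h2, h4, h3⟩
  have hu1 : u.1 ≠ 0 := fun h => hu (Prod.ext h hu2)
  obtain ⟨e, he, hmin⟩ := u.1.support.exists_min_image (fun e => e.1.1)
    (Finsupp.support_nonempty_iff.2 hu1)
  have hminu : ∀ e' : OrderedEdge G, u.1 e' ≠ 0 → e.1.1 ≤ e'.1.1 :=
    fun e' he' => hmin e' (Finsupp.mem_support_iff.2 he')
  -- Left ends of edges of v divide the common weight, hence are left ends of edges of u, so the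
  -- minimum carries over.
  have hminv : ∀ e' : OrderedEdge G, v.1 e' ≠ 0 → e.1.1 ≤ e'.1.1 := fun e' he' => by
    have h1 : (weight edgeExp u).2 (Sum.inlₗ e'.1.1) ≠ 0 :=
      huv ▸ weight_snd_ne_zero.2 (Or.inr ⟨e', he', edgeExp_inl.2 rfl⟩)
    obtain ⟨e'', h2, h3⟩ := (weight_snd_ne_zero.1 h1).resolve_left fun h' => h' (by rw [hu2]; rfl)
    exact edgeExp_inl.1 h3 ▸ hminu e'' h2
  have he := Finsupp.mem_support_iff.1 he
  have h1 : (weight edgeExp v).2 (Sum.inlₗ e.1.1) ≠ 0 :=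
    huv ▸ weight_snd_ne_zero.2 (Or.inr ⟨e, he, edgeExp_inl.2 rfl⟩)
  obtain ⟨e', he', h2⟩ := (weight_snd_ne_zero.1 h1).resolve_left fun h' => h' (by rw [hv2]; rfl)
  have hju : (weight edgeExp v).2 (Sum.inrₗ e.1.2) ≠ 0 :=
    huv ▸ weight_snd_ne_zero.2 (Or.inr ⟨e, he, edgeExp_inr.2 rfl⟩)
  have hjv : (weight edgeExp u).2 (Sum.inrₗ e'.1.2) ≠ 0 :=
    huv ▸ weight_snd_ne_zero.2 (Or.inr ⟨e', he', edgeExp_inr.2 rfl⟩)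
  have h2 := edgeExp_inl.1 h2
  obtain ⟨⟨i, j⟩, hij, aij⟩ := e
  obtain ⟨⟨i', k⟩, hik, aik⟩ := e'
  obtain rfl : i' = i := h2
  rcases lt_trichotomy j k with h | rfl | h
  · obtain ⟨v', hv', hz⟩ := exists_linked_of_lt hG hv2 hij h aij aik hminv he' hju
    exact ⟨u, v', _, Connected.refl _, hv', edgeVar_ne_zero _, edgeVar_le.2 he, hz⟩
  · exact ⟨u, v, _, Connected.refl _, Connected.refl _, edgeVar_ne_zero _, edgeVar_le.2 he,
      edgeVar_le.2 he'⟩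
  · obtain ⟨u', hu', hz⟩ := exists_linked_of_lt hG hu2 hik h aik aij hminu he hjv
    exact ⟨u', v, _, hu', Connected.refl _, edgeVar_ne_zero _, hz, edgeVar_le.2 he'⟩

lemma linked_of_weight_eq (hG : IsClosedLabelling K G)
    (u v : (OrderedEdge G →₀ ℕ) × (Var n →₀ ℕ)) (huv : weight edgeExp u = weight edgeExp v) :
    Linked G K u v :=
  connected_of_exists_common (exists_common hG) u v huv

lemma degree_edgeGen_eq :
    (fun e : OrderedEdge G => (sigma n).degree (edgeGen K e)) = edgeExp :=
  funext (degree_edgeGen K)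

lemma ker_reesHom_edgeGen_le (hG : IsClosedLabelling K G) :
    RingHom.ker (reesHom (edgeGen K : OrderedEdge G → _)) ≤ relationsUpTo (edgeGen K) 2 := by
  refine ker_reesHom_le_of_connected (m := sigma n) (edgeGen_ne_zero K) ?_
    (relationsUpTo_le_ker _ 2)
  rw [degree_edgeGen_eq]
  exact linked_of_weight_eq hG

lemma span_range_edgeGen :
    Ideal.span (Set.range (edgeGen K : OrderedEdge G → _)) = binomialEdgeIdeal K G := by
  rw [range_edgeGen, binomialEdgeIdeal]

lemma IsClosedLabelling.exists_weight_eq (hG : IsClosedLabelling K G) {k : ℕ}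
    {g : MvPolynomial (Var n) K} (hg0 : g ≠ 0) (hg : g ∈ binomialEdgeIdeal K G ^ k) :
    ∃ u : (OrderedEdge G →₀ ℕ) × (Var n →₀ ℕ),
      weight edgeExp u = (k, (sigma n).degree g) := by
  rw [← span_range_edgeGen] at hg
  have := exists_weight_eq_of_mem_pow (m := sigma n) (edgeGen_ne_zero K)
    (by rw [degree_edgeGen_eq]; exact linked_of_weight_eq hG) (relationsUpTo_le_ker _ 2) hg0 hg
  rwa [degree_edgeGen_eq] at this

end Connectivity

/-! ### The initial algebra of the Rees algebra -/

section InitialAlgebra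

variable {ι K : Type*} [Field K] {m : MonomialOrder ι}

/-- τ compares powers of t first, so the S-part is the σ-initial exponent of a single coefficient.
-/
lemma IsTauInitial.eq_degree {f : Polynomial (MvPolynomial ι K)} {a : ℕ × (ι →₀ ℕ)}
    (h : IsTauInitial m f a) : a.2 = m.degree (f.coeff a.1) := by
  have h0 : f.coeff a.1 ≠ 0 := fun h' => h.1 (by rw [h', coeff_zero])
  rcases h.2 (a.1, m.degree (f.coeff a.1)) (m.coeff_degree_ne_zero_iff.2 h0) with h1 | h1 | h1
  · exact (congrArg Prod.snd h1).symm
  · exact absurd h1 (lt_irrefl _)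
  · exact absurd h1.2 (not_lt.2 (m.le_degree (mem_support_iff.2 h.1)))

lemma isTauInitial_C_mul_X_pow {g : MvPolynomial ι K} (hg : g ≠ 0) (k : ℕ) :
    IsTauInitial m (Polynomial.C g * Polynomial.X ^ k) (k, m.degree g) := by
  simp only [IsTauInitial, Polynomial.coeff_C_mul_X_pow, if_true]
  refine ⟨m.coeff_degree_ne_zero_iff.2 hg, fun b hb => ?_⟩
  split_ifs at hb with h
  · rcases (m.le_degree (mem_support_iff.2 hb)).eq_or_lt with h1 | h1
    · exact Or.inl (Prod.ext h (m.toSyn.injective h1))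
    · exact Or.inr (Or.inr ⟨h, h1⟩)
  · exact absurd (coeff_zero _) hb

/-- The monomial algebra generated by the variables and the monomials `z ^ ε e * t`. -/
def monomialRees (K : Type*) [Field K] {E : Type*} (ε : E → ι →₀ ℕ) :
    Subalgebra K (Polynomial (MvPolynomial ι K)) :=
  Algebra.adjoin K (Set.range (fun s => Polynomial.C (X s)) ∪
    Set.range fun e => Polynomial.C (monomial (ε e) 1) * Polynomial.X)

variable {E : Type*} {ε : E → ι →₀ ℕ}

lemma C_mem_monomialRees (p : MvPolynomial ι K) : Polynomial.C p ∈ monomialRees K ε := by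
  induction p using MvPolynomial.induction_on with
  | C r => exact (monomialRees K ε).algebraMap_mem r
  | add p q hp hq => rw [map_add]; exact add_mem hp hq
  | mul_X p s hp =>
    rw [map_mul]
    exact mul_mem hp (Algebra.subset_adjoin (Or.inl ⟨s, rfl⟩))

lemma reesHom_mem_monomialRees (p : MvPolynomial E (MvPolynomial ι K)) :
    reesHom (fun e => monomial (ε e) 1) p ∈ monomialRees K ε := by
  induction p using MvPolynomial.induction_on with
  | C r =>
    rw [reesHom, aeval_C]
    exact C_mem_monomialRees r
  | add p q hp hq => rw [map_add]; exact add_mem hp hq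
  | mul_X p e hp =>
    rw [map_mul]
    refine mul_mem hp ?_
    rw [reesHom, aeval_X]
    exact Algebra.subset_adjoin (Or.inr ⟨e, rfl⟩)

lemma eval_mon_monomial (u : (E →₀ ℕ) × (ι →₀ ℕ)) :
    eval (fun e => monomial (ε e) 1) (mon K u) = monomial (weight ε u).2 1 := by
  rw [eval_mon, weight_apply, Finsupp.linearCombination_apply, Finsupp.prod, Finsupp.sum]
  simp only [monomial_pow, one_pow]
  rw [← monomial_sum_one, monomial_mul, one_mul]

lemma monomial_mem_monomialRees (u : (E →₀ ℕ) × (ι →₀ ℕ)) :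
    Polynomial.monomial (weight ε u).1 (monomial (weight ε u).2 (1 : K)) ∈ monomialRees K ε := by
  rw [← eval_mon_monomial, ← Polynomial.C_mul_X_pow_eq_monomial,
    ← reesHom_of_isHomogeneous _ (mon_isHomogeneous ε u)]
  exact reesHom_mem_monomialRees _

/-- Elements of the k-th power are values of k-forms in the generators. -/
lemma rees_span_monomial :
    rees (Ideal.span (Set.range fun e => monomial (ε e) (1 : K))) = monomialRees K ε := by
  apply le_antisymm
  · intro f hf
    rw [f.as_sum_support_C_mul_X_pow]
    refine sum_mem fun k _ => ?_
    obtain ⟨p, hp, hpk⟩ := (Ideal.mem_span_pow_iff_exists_isHomogeneous _ _).1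
      ((mem_reesAlgebra_iff _ f).1 hf k)
    rw [← hpk, ← reesHom_of_isHomogeneous _ hp]
    exact reesHom_mem_monomialRees p
  · refine Algebra.adjoin_le ?_
    rintro _ (⟨s, rfl⟩ | ⟨e, rfl⟩)
    · exact (reesAlgebra _).algebraMap_mem (X s)
    · refine (mem_reesAlgebra_iff _ _).2 fun k => ?_
      rw [Polynomial.coeff_C_mul_X]
      split_ifs with h
      · rw [h, pow_one]
        exact Ideal.subset_span ⟨e, rfl⟩
      · exact Ideal.zero_mem _

end InitialAlgebra

/-! ### Comparison of the initial algebra with the monomial Rees algebra -/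

section ReesGenerators

variable {n : ℕ} {G : SimpleGraph (Fin n)} {K : Type*} [Field K]

lemma reesGenerators_subset :
    reesGenerators K G ⊆ (rees (binomialEdgeIdeal K G) : Set (Polynomial _)) := by
  rintro _ ((⟨i, rfl⟩ | ⟨i, rfl⟩) | ⟨f, hf, rfl⟩)
  · exact (reesAlgebra _).algebraMap_mem (x K i)
  · exact (reesAlgebra _).algebraMap_mem (y K i)
  · refine (mem_reesAlgebra_iff _ _).2 fun k => ?_
    rw [Polynomial.coeff_C_mul_X]
    split_ifs with h
    · rw [h, pow_one]
      exact Ideal.subset_span hf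
    · exact Ideal.zero_mem _

lemma monomialRees_le_adjoin :
    monomialRees K (edgeExp : OrderedEdge G → _) ≤
      Algebra.adjoin K (tauInitialMonomials (sigma n) (reesGenerators K G)) := by
  have hC : ∀ s : Var n, Polynomial.C (X s) ∈ reesGenerators K G → Polynomial.C (X s) ∈
      tauInitialMonomials (sigma n) (reesGenerators K G) := fun s hs => by
    refine ⟨_, hs, (0, Finsupp.single s 1), ?_, by simp only [X, Polynomial.monomial_zero_left]⟩
    have := isTauInitial_C_mul_X_pow (m := sigma n) (X_ne_zero (R := K) s) 0
    rwa [pow_zero, mul_one, MonomialOrder.degree_X] at this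
  refine Algebra.adjoin_mono ?_
  rintro _ (⟨s, rfl⟩ | ⟨e, rfl⟩)
  · rcases var_cases s with ⟨i, rfl⟩ | ⟨i, rfl⟩
    · exact hC _ (Or.inl (Or.inl ⟨i, rfl⟩))
    · exact hC _ (Or.inl (Or.inr ⟨i, rfl⟩))
  · refine ⟨_, Or.inr ⟨edgeGen K e, range_edgeGen (G := G) K ▸ ⟨e, rfl⟩, rfl⟩, (1, edgeExp e),
      ?_, by rw [← Polynomial.C_mul_X_eq_monomial]⟩
    have := isTauInitial_C_mul_X_pow (m := sigma n) (edgeGen_ne_zero K e) 1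
    rwa [pow_one, degree_edgeGen] at this

/-- The lifting result enters here: the coefficient of t^k lies in J_G^k, so its initial exponent is
a weight of T-degree k. -/
lemma tauInitialAlgebra_le_monomialRees (hG : IsClosedLabelling K G) :
    tauInitialAlgebra (sigma n) (rees (binomialEdgeIdeal K G)) ≤
      monomialRees K (edgeExp : OrderedEdge G → _) := by
  refine Algebra.adjoin_le ?_
  rintro _ ⟨f, hf, a, ha, rfl⟩
  have h0 : f.coeff a.1 ≠ 0 := fun h' => ha.1 (by rw [h', coeff_zero])
  obtain ⟨u, hu⟩ := hG.exists_weight_eq h0 ((mem_reesAlgebra_iff _ f).1 hf a.1)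
  rw [← ha.eq_degree] at hu
  have := monomial_mem_monomialRees (K := K) (ε := edgeExp) u
  rwa [hu] at this

lemma rees_initialIdeal (hG : IsClosedLabelling K G) :
    rees (initialIdeal (sigma n) (binomialEdgeIdeal K G)) =
      monomialRees K (edgeExp : OrderedEdge G → _) := by
  rw [← hG.2, initialMonomials_edgeBinomials, ← Set.range_comp, ← rees_span_monomial]
  rfl

end ReesGenerators

end

end BinomialEdge

theorem theorem3p5 (K : Type*) [Field K] (n : ℕ) (G : SimpleGraph (Fin n))
    (hG : BinomialEdge.IsClosedLabelling K G) :
    BinomialEdge.tauInitialAlgebra (BinomialEdge.sigma n)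
        (BinomialEdge.rees (BinomialEdge.binomialEdgeIdeal K G)) =
      BinomialEdge.rees
        (BinomialEdge.initialIdeal (BinomialEdge.sigma n) (BinomialEdge.binomialEdgeIdeal K G)) ∧
    BinomialEdge.relationType (BinomialEdge.binomialEdgeIdeal K G) ≤ 2 ∧
    BinomialEdge.IsTauSagbiBasis (BinomialEdge.sigma n) (BinomialEdge.reesGenerators K G)
      (BinomialEdge.rees (BinomialEdge.binomialEdgeIdeal K G)) := by
  -- The inclusions `h1`, `h2`, `h3` form a cycle, so all three algebras coincide.
  have h1 := BinomialEdge.tauInitialAlgebra_le_monomialRees hG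
  have h2 := BinomialEdge.monomialRees_le_adjoin (K := K) (G := G)
  have h3 : Algebra.adjoin K (BinomialEdge.tauInitialMonomials (BinomialEdge.sigma n)
      (BinomialEdge.reesGenerators K G)) ≤ BinomialEdge.tauInitialAlgebra (BinomialEdge.sigma n)
        (BinomialEdge.rees (BinomialEdge.binomialEdgeIdeal K G)) :=
    Algebra.adjoin_mono fun _ ⟨f, hf, h⟩ => ⟨f, BinomialEdge.reesGenerators_subset hf, h⟩
  refine ⟨?_, ?_, BinomialEdge.reesGenerators_subset, le_antisymm h3 (h1.trans h2)⟩
  · rw [BinomialEdge.rees_initialIdeal hG]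
    exact le_antisymm h1 (h2.trans h3)
  · exact BinomialEdge.relationType_le one_le_two BinomialEdge.span_range_edgeGen
      (BinomialEdge.ker_reesHom_edgeGen_le hG)
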